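/- Let $I\subseteq\mathbb R$ be an open interval (bounded or unbounded) and let $f\colon I\to\mathbb R$ be continuous and strictly monotone (increasing or decreasing). Let $A_f\colon \bigcup_{n\ge 1} I^n\to I$ be the quasiarithmetic mean generated by $f$, $$A_f(a_1,\dots,a_n)=f^{-1}\Big(\frac{f(a_1)+\cdots+f(a_n)}{n}\Big)\qquad (n\ge 1,\ a_1,\dots,a_n\in I).$$ Call $A_f$ convex if, for every $n\ge 1$, its restriction to $I^n$ is a convex function of $n$ variables. Then $A_f$ is convex if and only if both of the following conditions hold: 1. $f$ is twice continuously differentiable on $I$ and $f'(x)\neq 0$ for all $x\in I$; 2. either $f''(x)\ne 0$ for all $x\in I$ and the function $f'/f''$ is positive and concave on $I$, or $f''(x)=0$ for all $x\in I$. -/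

import Mathlib

/-- The quasiarithmetic mean generated by `f` on `I`, evaluated at the `n`-tuple `a`:
`f⁻¹ ((f a₁ + ⋯ + f aₙ) / n)`, where `f⁻¹` is the inverse of `f` restricted to `I`.
For `f` continuous and injective on an interval `I`, `n ≥ 1` and `a ∈ Iⁿ`, the argument of `f⁻¹`
lies in `f(I)`, so this is the unique point of `I` with that `f`-value. -/
noncomputable def quasiMean (I : Set ℝ) (f : ℝ → ℝ) {n : ℕ} (a : Fin n → ℝ) : ℝ :=
  Function.invFunOn f I ((∑ i, f (a i)) / n)

/-- Convexity of the quasiarithmetic mean, as a function on `⋃ n ≥ 1, Iⁿ`: for every `n ≥ 1` its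
restriction to `Iⁿ` is a convex function of `n` variables. -/
def QuasiMeanConvex (I : Set ℝ) (f : ℝ → ℝ) : Prop :=
  ∀ n : ℕ, 1 ≤ n → ConvexOn ℝ (Set.univ.pi fun _ : Fin n => I) (quasiMean I f)

/-- Twice continuously differentiable on the open set `I`, with nowhere vanishing derivative. -/
def C2Sharp (I : Set ℝ) (f : ℝ → ℝ) : Prop :=
  ContDiffOn ℝ 2 f I ∧ ∀ x ∈ I, deriv f x ≠ 0

/-! Replacing f by -f changes neither the mean nor f'/f'', so f may be taken increasing. Write M(x,
y) for the mean of two points and k for the inverse of f.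

Necessity uses only n = 2. From f(x) = 2 f(M(x, y)) - f(y), one-sided derivatives of the convex map
x ↦ M(x, y) pass to f at x whenever f is differentiable at M(x, y); monotone functions are
differentiable almost everywhere, so such pairs abound, and f turns out differentiable with f' > 0
nondecreasing, hence continuous by Darboux. The supporting hyperplane inequality, tested on the
diagonal, makes (k - y) · (f' ∘ k) convex for each y; varying y yields a continuous f''.
Nonnegativity of the Hessian then forces f'' to vanish everywhere or nowhere, and in the latter case
(f'²/f'') ∘ k is concave.

The one-sided derivatives of f'/f'' at x and of (f'²/f'') ∘ k at f(x) differ by a constant, so the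
two concavity conditions are equivalent. Conversely, concavity of (f'²/f'') ∘ k gives a nonnegative
Hessian for every n, by Jensen and Cauchy-Schwarz. -/

open Set Filter Topology

/-! ### Convexity and one-sided derivatives in one variable -/

/-- A continuous midpoint-convex function on a convex set of reals is convex. -/
theorem convexOn_of_midpoint_le {s : Set ℝ} {f : ℝ → ℝ} (hs : Convex ℝ s)
    (hf : ContinuousOn f s)
    (hmid : ∀ x ∈ s, ∀ y ∈ s, f ((x + y) / 2) ≤ (f x + f y) / 2) : ConvexOn ℝ s f := by
  refine LinearOrder.convexOn_of_lt hs fun x hx y hy hxy a b ha hb hab => ?_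
  have hsub : Icc x y ⊆ s := hs.ordConnected.out hx hy
  set c : ℝ := (f y - f x) / (y - x) with hc
  have hcm : c * (y - x) = f y - f x := div_mul_cancel₀ _ (sub_pos.2 hxy).ne'
  -- Subtracting the chord reduces convexity to `g ≤ 0`, with `g` zero at both ends.
  set g : ℝ → ℝ := fun z => f z - f x - c * (z - x) with hg
  have hgc : ContinuousOn g (Icc x y) := by
    have := hf.mono hsub
    fun_prop
  have gx : g x = 0 := by simp [hg]
  have gy : g y = 0 := by simp only [hg]; linarith
  have hgmid : ∀ z ∈ Icc x y, ∀ w ∈ Icc x y, g ((z + w) / 2) ≤ (g z + g w) / 2 := by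
    intro z hz w hw
    have := hmid z (hsub hz) w (hsub hw)
    simp only [hg]
    linarith
  obtain ⟨p, hp, hpmax⟩ := isCompact_Icc.exists_isMaxOn (nonempty_Icc.2 hxy.le) hgc
  have hle : ∀ z ∈ Icc x y, g z ≤ 0 := by
    by_contra! hcon
    obtain ⟨z, hz, hz0⟩ := hcon
    have hp0 : 0 < g p := hz0.trans_le (hpmax hz)
    -- A positive maximum has a leftmost maximiser `q`, interior to the interval; midpoint convexity
    -- at `q ± e` would make `q - e` a maximiser too.
    have hT : IsCompact (Icc x y ∩ g ⁻¹' {g p}) :=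
      isCompact_Icc.of_isClosed_subset
        (hgc.preimage_isClosed_of_isClosed isClosed_Icc isClosed_singleton) inter_subset_left
    obtain ⟨q, ⟨hq, hqp⟩, hqmin⟩ := hT.exists_isLeast ⟨p, hp, rfl⟩
    have hqp : g q = g p := hqp
    have hxq : x < q := lt_of_le_of_ne hq.1 (by rintro rfl; linarith)
    have hqy : q < y := lt_of_le_of_ne hq.2 (by rintro rfl; linarith)
    set e := min (q - x) (y - q)
    have he : 0 < e := lt_min (sub_pos.2 hxq) (sub_pos.2 hqy)
    have he1 : e ≤ q - x := min_le_left _ _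
    have he2 : e ≤ y - q := min_le_right _ _
    have m1 : q - e ∈ Icc x y := ⟨by linarith, by linarith⟩
    have m2 : q + e ∈ Icc x y := ⟨by linarith, by linarith⟩
    have h1 := hgmid _ m1 _ m2
    rw [show (q - e + (q + e)) / 2 = q by ring] at h1
    have h2 : g (q + e) ≤ g p := hpmax m2
    have h3 : g (q - e) ≤ g p := hpmax m1
    have h4 : g (q - e) = g p := by linarith
    have := hqmin ⟨m1, h4⟩
    linarith
  have hm : a • x + b • y ∈ Icc x y :=
    (convex_Icc x y) (left_mem_Icc.2 hxy.le) (right_mem_Icc.2 hxy.le) ha.le hb.le hab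
  have h5 := hle _ hm
  obtain rfl : a = 1 - b := by linarith
  simp only [hg, smul_eq_mul] at h5 ⊢
  have : c * ((1 - b) * x + b * y - x) = b * (f y - f x) := by rw [← hcm]; ring
  linarith

/-- A continuous function with monotone right derivative is convex. -/
theorem convexOn_of_monotoneOn_rightDeriv {s : Set ℝ} {f D : ℝ → ℝ} (hs : Convex ℝ s)
    (hf : ContinuousOn f s) (hD : ∀ x ∈ s, HasDerivWithinAt f (D x) (Ioi x) x)
    (hmono : MonotoneOn D s) : ConvexOn ℝ s f := by
  refine convexOn_of_slope_mono_adjacent hs fun {x y z} hx hz hxy hyz => ?_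
  have hsub : Icc x z ⊆ s := hs.ordConnected.out hx hz
  have hy : y ∈ s := hsub ⟨hxy.le, hyz.le⟩
  have lin : ∀ p t : ℝ, HasDerivAt (fun w => f p + D y * (w - p)) (D y) t := by
    intro p t
    simpa using (((hasDerivAt_id t).sub_const p).const_mul (D y)).const_add (f p)
  -- Both adjacent slopes are compared with `D y`, which bounds `D` from above on the left of `y`
  -- and from below on the right.
  have h1 : f y ≤ f x + D y * (y - x) := by
    refine image_le_of_deriv_right_le_deriv_boundary (f := f) (f' := D) (a := x) (b := y)
      (B := fun w => f x + D y * (w - x)) (B' := fun _ => D y)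
      (hf.mono fun t ht => hsub ⟨ht.1, ht.2.trans hyz.le⟩)
      (fun t ht => (hD t (hsub ⟨ht.1, ht.2.le.trans hyz.le⟩)).Ici_of_Ioi) (by simp)
      (fun t _ => (lin x t).continuousAt.continuousWithinAt)
      (fun t _ => (lin x t).hasDerivWithinAt)
      (fun t ht => hmono (hsub ⟨ht.1, ht.2.le.trans hyz.le⟩) hy ht.2.le) ⟨hxy.le, le_rfl⟩
  have h2 : f y + D y * (z - y) ≤ f z := by
    refine image_le_of_deriv_right_le_deriv_boundary (f := fun w => f y + D y * (w - y))
      (f' := fun _ => D y) (a := y) (b := z) (B := f) (B' := D)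
      (fun t _ => (lin y t).continuousAt.continuousWithinAt)
      (fun t _ => (lin y t).hasDerivWithinAt) (by simp)
      (hf.mono fun t ht => hsub ⟨hxy.le.trans ht.1, ht.2⟩)
      (fun t ht => (hD t (hsub ⟨hxy.le.trans ht.1, ht.2.le⟩)).Ici_of_Ioi)
      (fun t ht => hmono hy (hsub ⟨hxy.le.trans ht.1, ht.2.le⟩) ht.1) ⟨hyz.le, le_rfl⟩
  calc (f y - f x) / (y - x) ≤ D y := by
        rw [div_le_iff₀ (sub_pos.2 hxy)]; linarith
    _ ≤ (f z - f y) / (z - y) := by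
        rw [le_div_iff₀ (sub_pos.2 hyz)]; linarith

/-- A monotone derivative is continuous, by Darboux's theorem. -/
theorem continuousOn_of_monotoneOn_hasDerivAt {s : Set ℝ} {f f' : ℝ → ℝ} (hso : IsOpen s)
    (hs : s.OrdConnected) (hf : ∀ x ∈ s, HasDerivAt f (f' x) x) (hmono : MonotoneOn f' s) :
    ContinuousOn f' s := by
  have him : (f' '' s).OrdConnected :=
    hs.image_hasDerivWithinAt fun x hx => (hf x hx).hasDerivWithinAt
  intro x hx
  have hnhds := hso.mem_nhds hx
  obtain ⟨l, u, hxlu, hlu⟩ := mem_nhds_iff_exists_Ioo_subset.1 hnhds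
  refine ContinuousAt.continuousWithinAt (tendsto_order.2 ⟨fun b hb => ?_, fun b hb => ?_⟩)
  · suffices ∃ q ∈ s, q < x ∧ b < f' q by
      obtain ⟨q, hq, hqx, hbq⟩ := this
      filter_upwards [hnhds, lt_mem_nhds hqx] with z hz hqz
      exact hbq.trans_le (hmono hq hz hqz.le)
    obtain ⟨p, hp1, hp2⟩ := exists_between hxlu.1
    have hp : p ∈ s := hlu ⟨hp1, hp2.trans hxlu.2⟩
    by_cases hc : b < f' p
    · exact ⟨p, hp, hp2, hc⟩
    -- Darboux: the intermediate value `c` is attained, and monotonicity places the point to the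
    -- left of `x`.
    · obtain ⟨c, hc1, hc2⟩ := exists_between hb
      obtain ⟨q, hq, rfl⟩ := him.out (mem_image_of_mem _ hp) (mem_image_of_mem _ hx)
        ⟨(not_lt.1 hc).trans hc1.le, hc2.le⟩
      exact ⟨q, hq, hmono.reflect_lt hq hx hc2, hc1⟩
  · suffices ∃ q ∈ s, x < q ∧ f' q < b by
      obtain ⟨q, hq, hqx, hbq⟩ := this
      filter_upwards [hnhds, gt_mem_nhds hqx] with z hz hqz
      exact (hmono hz hq hqz.le).trans_lt hbq
    obtain ⟨p, hp1, hp2⟩ := exists_between hxlu.2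
    have hp : p ∈ s := hlu ⟨hxlu.1.trans hp1, hp2⟩
    by_cases hc : f' p < b
    · exact ⟨p, hp, hp1, hc⟩
    · obtain ⟨c, hc1, hc2⟩ := exists_between hb
      obtain ⟨q, hq, rfl⟩ := him.out (mem_image_of_mem _ hx) (mem_image_of_mem _ hp)
        ⟨hc1.le, hc2.le.trans (not_lt.1 hc)⟩
      exact ⟨q, hq, hmono.reflect_lt hx hq hc1, hc2⟩

theorem HasDerivWithinAt.comp_of_eventually_mem {s t : Set ℝ} {p k : ℝ → ℝ} {p' k' x y : ℝ}
    (hp : HasDerivWithinAt p p' t y) (hk : HasDerivWithinAt k k' s x) (hy : k x = y)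
    (hkt : ∀ᶠ z in 𝓝[s] x, k z ∈ t) :
    HasDerivWithinAt (fun z => p (k z)) (p' * k') s x := by
  subst hy
  have h := HasDerivWithinAt.comp x hp (hk.mono (inter_subset_left (t := k ⁻¹' t)))
    fun z hz => hz.2
  exact (hasDerivWithinAt_inter' hkt).1 h

theorem hasDerivAt_of_Iio_Ioi {f : ℝ → ℝ} {d x : ℝ} (hl : HasDerivWithinAt f d (Iio x) x)
    (hr : HasDerivWithinAt f d (Ioi x) x) : HasDerivAt f d x := by
  have := hl.union hr
  rw [Iio_union_Ioi] at this
  rwa [← hasDerivWithinAt_univ, ← hasDerivWithinAt_sdiff_singleton (s := univ) (x := x),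
    ← compl_eq_univ_sdiff]

theorem accPt_of_mem_nhds {s : Set ℝ} {x : ℝ} (hs : s ∈ 𝓝 x) : AccPt x (𝓟 s) := by
  rw [accPt_iff_frequently_nhdsNE]
  exact Eventually.frequently (mem_nhdsWithin_of_mem_nhds hs)

/-- The derivative of a convex function is nondecreasing, so its derivative is nonnegative. -/
theorem ConvexOn.second_deriv_nonneg {s : Set ℝ} {f f' : ℝ → ℝ} {f'' x : ℝ}
    (hconv : ConvexOn ℝ s f) (hs : s ∈ 𝓝 x) (hf : ∀ t ∈ s, HasDerivAt f (f' t) t)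
    (hf' : HasDerivAt f' f'' x) : 0 ≤ f'' := by
  have hm : MonotoneOn f' s :=
    (hconv.monotoneOn_deriv fun t ht => (hf t ht).differentiableAt).congr
      fun t ht => (hf t ht).deriv
  exact hf'.hasDerivWithinAt.nonneg_of_monotoneOn (accPt_of_mem_nhds hs) hm

/-! ### Increasing generators and their inverses -/

/-- A continuous strictly increasing function on an open interval. -/
structure IsIncreasingGenerator (I : Set ℝ) (f : ℝ → ℝ) : Prop where
  isOpen : IsOpen I
  ordConnected : I.OrdConnected
  continuousOn : ContinuousOn f I
  strictMonoOn : StrictMonoOn f I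

namespace IsIncreasingGenerator

variable {I : Set ℝ} {f : ℝ → ℝ}

theorem convex (hf : IsIncreasingGenerator I f) : Convex ℝ I := hf.ordConnected.convex

theorem convex_image (hf : IsIncreasingGenerator I f) : Convex ℝ (f '' I) :=
  (hf.ordConnected.isPreconnected.image f hf.continuousOn).ordConnected.convex

theorem isOpen_image (hf : IsIncreasingGenerator I f) : IsOpen (f '' I) := by
  rw [isOpen_iff_mem_nhds]
  rintro _ ⟨x, hx, rfl⟩
  obtain ⟨l, u, hxlu, hlu⟩ := mem_nhds_iff_exists_Ioo_subset.1 (hf.isOpen.mem_nhds hx)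
  obtain ⟨p, hp1, hp2⟩ := exists_between hxlu.1
  obtain ⟨q, hq1, hq2⟩ := exists_between hxlu.2
  have hp : p ∈ I := hlu ⟨hp1, hp2.trans hxlu.2⟩
  have hq : q ∈ I := hlu ⟨hxlu.1.trans hq1, hq2⟩
  exact mem_of_superset (Icc_mem_nhds (hf.strictMonoOn hp hx hp2) (hf.strictMonoOn hx hq hq1))
    (hf.convex_image.ordConnected.out (mem_image_of_mem f hp) (mem_image_of_mem f hq))

theorem image_mem_nhds (hf : IsIncreasingGenerator I f) {x : ℝ} (hx : x ∈ I) :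
    f '' I ∈ 𝓝 (f x) := hf.isOpen_image.mem_nhds (mem_image_of_mem f hx)

theorem continuousAt (hf : IsIncreasingGenerator I f) {x : ℝ} (hx : x ∈ I) :
    ContinuousAt f x := hf.continuousOn.continuousAt (hf.isOpen.mem_nhds hx)

theorem inv_apply (hf : IsIncreasingGenerator I f) {x : ℝ} (hx : x ∈ I) :
    Function.invFunOn f I (f x) = x :=
  hf.strictMonoOn.injOn.leftInvOn_invFunOn hx

theorem inv_mem {s : ℝ} (hs : s ∈ f '' I) : Function.invFunOn f I s ∈ I :=
  Function.invFunOn_mem hs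

theorem apply_inv {s : ℝ} (hs : s ∈ f '' I) : f (Function.invFunOn f I s) = s :=
  Function.invFunOn_eq hs

theorem inv_strictMonoOn (hf : IsIncreasingGenerator I f) :
    StrictMonoOn (Function.invFunOn f I) (f '' I) := by
  rintro _ ⟨x, hx, rfl⟩ _ ⟨y, hy, rfl⟩ h
  rw [hf.inv_apply hx, hf.inv_apply hy]
  exact hf.strictMonoOn.lt_iff_lt hx hy |>.1 h

theorem inv_image (hf : IsIncreasingGenerator I f) :
    Function.invFunOn f I '' (f '' I) = I := by
  ext x
  constructor
  · rintro ⟨s, hs, rfl⟩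
    exact inv_mem hs
  · exact fun hx => ⟨f x, mem_image_of_mem f hx, hf.inv_apply hx⟩

theorem inv_continuousAt (hf : IsIncreasingGenerator I f) {s : ℝ} (hs : s ∈ f '' I) :
    ContinuousAt (Function.invFunOn f I) s :=
  hf.inv_strictMonoOn.continuousAt_of_image_mem_nhds (hf.isOpen_image.mem_nhds hs)
    (by rw [hf.inv_image]; exact hf.isOpen.mem_nhds (inv_mem hs))

theorem inv_hasDerivAt (hf : IsIncreasingGenerator I f) {s d : ℝ} (hs : s ∈ f '' I)
    (hd : HasDerivAt f d (Function.invFunOn f I s)) (hd0 : d ≠ 0) :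
    HasDerivAt (Function.invFunOn f I) d⁻¹ s := by
  refine HasDerivAt.of_local_left_inverse (hf.inv_continuousAt hs) hd hd0 ?_
  filter_upwards [hf.isOpen_image.mem_nhds hs] with t ht using apply_inv ht

theorem mean_mem_image (hf : IsIncreasingGenerator I f) {n : ℕ} (hn : 1 ≤ n) {a : Fin n → ℝ}
    (ha : ∀ i, a i ∈ I) : (∑ i, f (a i)) / n ∈ f '' I := by
  have hn0 : (n : ℝ) ≠ 0 := by positivity
  have := hf.convex_image.sum_mem (t := Finset.univ) (w := fun _ : Fin n => (n : ℝ)⁻¹)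
    (z := fun i => f (a i)) (fun _ _ => by positivity) (by simp [hn0])
    (fun i _ => mem_image_of_mem f (ha i))
  simpa [← Finset.mul_sum, div_eq_inv_mul] using this

theorem mid_mem_image (hf : IsIncreasingGenerator I f) {x y : ℝ} (hx : x ∈ I) (hy : y ∈ I) :
    (f x + f y) / 2 ∈ f '' I := by
  have := hf.mean_mem_image (n := 2) (by norm_num) (a := ![x, y]) (by simp [Fin.forall_fin_two, *])
  simpa using this

theorem inv_mid_self (hf : IsIncreasingGenerator I f) {x : ℝ} (hx : x ∈ I) :
    Function.invFunOn f I ((f x + f x) / 2) = x := by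
  rw [add_self_div_two, hf.inv_apply hx]

/-- Since f(I) is open, every m near x is a mean M(x, y). The primed version fixes m and moves x. -/
theorem eventually_exists_reflection (hf : IsIncreasingGenerator I f) {x : ℝ} (hx : x ∈ I) :
    ∀ᶠ m in 𝓝 x, ∃ y ∈ I, f y = 2 * f m - f x := by
  have hc : ContinuousAt (fun m => 2 * f m - f x) x :=
    ((hf.continuousAt hx).const_mul 2).sub continuousAt_const
  have h := hc.preimage_mem_nhds (t := f '' I)
    (by rw [show 2 * f x - f x = f x by ring]; exact hf.image_mem_nhds hx)
  filter_upwards [h] with m hm using hm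

theorem eventually_exists_reflection' (hf : IsIncreasingGenerator I f) {m : ℝ} (hm : m ∈ I) :
    ∀ᶠ x in 𝓝 m, ∃ y ∈ I, f y = 2 * f m - f x := by
  have hc : ContinuousAt (fun x => 2 * f m - f x) m :=
    continuousAt_const.sub (hf.continuousAt hm)
  have h := hc.preimage_mem_nhds (t := f '' I)
    (by rw [show 2 * f m - f m = f m by ring]; exact hf.image_mem_nhds hm)
  filter_upwards [h] with x hx using hx

end IsIncreasingGenerator

/-! ### Continuous differentiability of the generator -/

/-- Convexity of the two-variable mean. -/
theorem QuasiMeanConvex.convexOn_pair {I : Set ℝ} {f : ℝ → ℝ} (h : QuasiMeanConvex I f) :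
    ConvexOn ℝ (I ×ˢ I) fun p : ℝ × ℝ => Function.invFunOn f I ((f p.1 + f p.2) / 2) := by
  let g : ℝ × ℝ →ₗ[ℝ] (Fin 2 → ℝ) :=
    { toFun := fun p => ![p.1, p.2]
      map_add' := fun p q => by ext i; fin_cases i <;> simp
      map_smul' := fun c p => by ext i; fin_cases i <;> simp }
  have := (h 2 (by norm_num)).comp_linearMap g
  have hset : g ⁻¹' (Set.univ.pi fun _ : Fin 2 => I) = I ×ˢ I := by
    ext p
    simp [g, Set.mem_pi, Fin.forall_fin_two]
  have hfun : quasiMean I f ∘ g = fun p => Function.invFunOn f I ((f p.1 + f p.2) / 2) := by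
    ext p
    simp [g, quasiMean]
  rwa [hset, hfun] at this

theorem QuasiMeanConvex.convexOn_left {I : Set ℝ} {f : ℝ → ℝ} (h : QuasiMeanConvex I f)
    (hI : Convex ℝ I) {y : ℝ} (hy : y ∈ I) :
    ConvexOn ℝ I fun x => Function.invFunOn f I ((f x + f y) / 2) := by
  refine ⟨hI, fun x hx x' hx' a b ha hb hab => ?_⟩
  have := h.convexOn_pair.2 (x := (x, y)) ⟨hx, hy⟩ (y := (x', y)) ⟨hx', hy⟩ ha hb hab
  simpa [← add_mul, hab] using this

namespace IsIncreasingGenerator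

variable {I : Set ℝ} {f : ℝ → ℝ}

/-- Lebesgue's theorem on monotone functions: the exceptional set is null, so it cannot contain an
interval around x. -/
theorem frequently_differentiableAt (hf : IsIncreasingGenerator I f) {x : ℝ} (hx : x ∈ I)
    {p : ℝ → Prop} (hp : ∀ᶠ m in 𝓝 x, p m) : ∃ m ∈ I, p m ∧ DifferentiableAt ℝ f m := by
  have hae := hf.strictMonoOn.monotoneOn.ae_differentiableWithinAt_of_mem
  obtain ⟨l, u, hxlu, hlu⟩ := mem_nhds_iff_exists_Ioo_subset.1
    (hp.and (hf.isOpen.mem_nhds hx))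
  by_contra! hcon
  have hnull : MeasureTheory.volume (Ioo l u) = 0 := by
    refine MeasureTheory.measure_mono_null (fun m hm => ?_) hae
    intro hd
    have hm' := hlu hm
    exact hcon m hm'.2 hm'.1
      ((hd hm'.2).differentiableAt (hf.isOpen.mem_nhds hm'.2))
  rw [Real.volume_Ioo, ENNReal.ofReal_eq_zero] at hnull
  linarith [hxlu.1, hxlu.2]

theorem inv_mid_strictMonoOn (hf : IsIncreasingGenerator I f) {y : ℝ} (hy : y ∈ I) :
    StrictMonoOn (fun x => Function.invFunOn f I ((f x + f y) / 2)) I := by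
  intro x hx x' hx' h
  refine hf.inv_strictMonoOn (hf.mid_mem_image hx hy) (hf.mid_mem_image hx' hy) ?_
  have := hf.strictMonoOn hx hx' h
  linarith

/-- One-sided derivatives of the partial mean `x ↦ M(x, y)`. -/
theorem exists_oneSided_deriv_mid (hf : IsIncreasingGenerator I f) (h : QuasiMeanConvex I f)
    {x y : ℝ} (hx : x ∈ I) (hy : y ∈ I) :
    ∃ l r : ℝ, 0 < l ∧ l ≤ r ∧
      HasDerivWithinAt (fun x => Function.invFunOn f I ((f x + f y) / 2)) l (Iio x) x ∧
      HasDerivWithinAt (fun x => Function.invFunOn f I ((f x + f y) / 2)) r (Ioi x) x := by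
  have hc := h.convexOn_left hf.convex hy
  have hxi : x ∈ interior I := by rwa [hf.isOpen.interior_eq]
  refine ⟨_, _, ?_, hc.leftDeriv_le_rightDeriv_of_mem_interior hxi,
    hc.hasDerivWithinAt_leftDeriv_of_mem_interior hxi,
    hc.hasDerivWithinAt_rightDeriv_of_mem_interior hxi⟩
  -- The left derivative dominates a secant slope from the left, which is positive by strict
  -- monotonicity.
  obtain ⟨l, u, hxlu, hlu⟩ := mem_nhds_iff_exists_Ioo_subset.1 (hf.isOpen.mem_nhds hx)
  obtain ⟨p, hp1, hp2⟩ := exists_between hxlu.1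
  have hp : p ∈ I := hlu ⟨hp1, hp2.trans hxlu.2⟩
  refine lt_of_lt_of_le ?_ (hc.slope_le_leftDeriv_of_mem_interior hp hxi hp2)
  rw [slope_def_field]
  exact div_pos (sub_pos.2 (hf.inv_mid_strictMonoOn hy hp hx hp2)) (sub_pos.2 hp2)

theorem inv_mid_eq (hf : IsIncreasingGenerator I f) {x y m : ℝ} (hm : m ∈ I)
    (hyx : f y = 2 * f m - f x) : Function.invFunOn f I ((f x + f y) / 2) = m := by
  rw [hyx, show (f x + (2 * f m - f x)) / 2 = f m by ring, hf.inv_apply hm]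

/-- Differentiability at the mean transfers to one-sided differentiability at the arguments. -/
theorem exists_oneSided_deriv_of_reflection (hf : IsIncreasingGenerator I f)
    (h : QuasiMeanConvex I f) {x y m d : ℝ} (hx : x ∈ I) (hy : y ∈ I) (hm : m ∈ I)
    (hyx : f y = 2 * f m - f x) (hd : HasDerivAt f d m) :
    ∃ l r : ℝ, 0 < l ∧ l ≤ r ∧
      HasDerivWithinAt f (2 * d * l) (Iio x) x ∧ HasDerivWithinAt f (2 * d * r) (Ioi x) x := by
  obtain ⟨l, r, hl0, hlr, hl, hr⟩ := hf.exists_oneSided_deriv_mid h hx hy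
  -- Chain rule applied to f(z) = 2 f(M(z, y)) - f(y), whose inner map takes the value m at x.
  have key : ∀ (c : ℝ) (s : Set ℝ),
      HasDerivWithinAt (fun x => Function.invFunOn f I ((f x + f y) / 2)) c s x →
        HasDerivWithinAt f (2 * d * c) s x := by
    intro c s hs
    have h1 := hd.hasDerivWithinAt (s := univ)
    have h2 := ((h1.comp_of_eventually_mem hs (hf.inv_mid_eq hm hyx) (by simp)).const_mul 2).sub_const (f y)
    have heq : ∀ z ∈ I, f z = 2 * f (Function.invFunOn f I ((f z + f y) / 2)) - f y := by
      intro z hz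
      rw [apply_inv (hf.mid_mem_image hz hy)]
      ring
    refine (h2.congr_of_eventuallyEq ?_ (heq x hx)).congr_deriv (by ring)
    filter_upwards [mem_nhdsWithin_of_mem_nhds (hf.isOpen.mem_nhds hx)] with z hz using heq z hz
  exact ⟨l, r, hl0, hlr, key l _ hl, key r _ hr⟩

/-- A zero derivative at m would pass by reflection to all nearby points, making f locally constant.
-/
theorem deriv_pos_of_hasDerivAt (hf : IsIncreasingGenerator I f) (h : QuasiMeanConvex I f)
    {m d : ℝ} (hm : m ∈ I) (hd : HasDerivAt f d m) : 0 < d := by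
  have hd0 : 0 ≤ d := by
    have hacc := accPt_of_mem_nhds (hf.isOpen.mem_nhds hm)
    exact hd.hasDerivWithinAt.nonneg_of_monotoneOn hacc hf.strictMonoOn.monotoneOn
  refine lt_of_le_of_ne hd0 fun hzero => ?_
  subst hzero
  have hloc : ∀ᶠ x in 𝓝 m, HasDerivAt f 0 x := by
    filter_upwards [hf.eventually_exists_reflection' hm, hf.isOpen.mem_nhds hm]
      with x ⟨y, hy, hyx⟩ hx
    obtain ⟨l, r, -, -, hl, hr⟩ := hf.exists_oneSided_deriv_of_reflection h hx hy hm hyx hd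
    exact hasDerivAt_of_Iio_Ioi (by simpa using hl) (by simpa using hr)
  obtain ⟨l, u, hxlu, hlu⟩ := mem_nhds_iff_exists_Ioo_subset.1
    (hloc.and (hf.isOpen.mem_nhds hm))
  obtain ⟨q, hq1, hq2⟩ := exists_between hxlu.2
  have hsub : ∀ z ∈ Icc m q, HasDerivAt f 0 z ∧ z ∈ I := fun z hz =>
    hlu ⟨hxlu.1.trans_le hz.1, hz.2.trans_lt hq2⟩
  obtain ⟨c, -, hc⟩ := exists_hasDerivAt_eq_slope f (fun _ => 0) hq1
    (fun z hz => (hsub z hz).1.continuousAt.continuousWithinAt)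
    (fun z hz => (hsub z (Ioo_subset_Icc_self hz)).1)
  have hlt := hf.strictMonoOn hm (hsub q ⟨hq1.le, le_rfl⟩).2 hq1
  have : 0 < (f q - f m) / (q - m) := div_pos (sub_pos.2 hlt) (sub_pos.2 hq1)
  linarith

theorem exists_oneSided_deriv (hf : IsIncreasingGenerator I f) (h : QuasiMeanConvex I f)
    {x : ℝ} (hx : x ∈ I) :
    ∃ l r : ℝ, 0 < l ∧ l ≤ r ∧ HasDerivWithinAt f l (Iio x) x ∧
      HasDerivWithinAt f r (Ioi x) x := by
  obtain ⟨m, hm, ⟨y, hy, hyx⟩, hd⟩ :=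
    hf.frequently_differentiableAt hx (hf.eventually_exists_reflection hx)
  have hd0 := hf.deriv_pos_of_hasDerivAt h hm hd.hasDerivAt
  obtain ⟨l, r, hl0, hlr, hl, hr⟩ :=
    hf.exists_oneSided_deriv_of_reflection h hx hy hm hyx hd.hasDerivAt
  exact ⟨_, _, by positivity, by gcongr, hl, hr⟩

/-- The generator of a convex quasiarithmetic mean is differentiable: a kink of `f` would be a
concave kink of a partial mean. -/
theorem hasDerivAt_deriv (hf : IsIncreasingGenerator I f) (h : QuasiMeanConvex I f)
    {m : ℝ} (hm : m ∈ I) : HasDerivAt f (deriv f m) m := by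
  obtain ⟨x, hx, ⟨y, hy, hyx⟩, hd⟩ :=
    hf.frequently_differentiableAt hm (hf.eventually_exists_reflection' hm)
  obtain ⟨L, R, hL0, hLR, hL, hR⟩ := hf.exists_oneSided_deriv h hm
  obtain ⟨l, r, hl0, hlr, hl, hr⟩ := hf.exists_oneSided_deriv_mid h hx hy
  have hφ := hf.inv_mid_eq hm hyx
  have hI : ∀ s, ∀ᶠ z in 𝓝[s] x, z ∈ I := fun s =>
    mem_nhdsWithin_of_mem_nhds (hf.isOpen.mem_nhds hx)
  have hmid : ∀ s, HasDerivWithinAt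
      (fun z => f (Function.invFunOn f I ((f z + f y) / 2))) (deriv f x / 2) s x := by
    intro s
    refine ((hd.hasDerivAt.add_const (f y)).div_const 2).hasDerivWithinAt.congr_of_eventuallyEq
      ?_ (apply_inv (hf.mid_mem_image hx hy))
    filter_upwards [hI s] with z hz using apply_inv (hf.mid_mem_image hz hy)
  -- The partial mean is increasing, so it preserves sides and the one-sided chain rules apply. Both
  -- products equal f'(x)/2, which with 0 < l ≤ r and 0 < L ≤ R leaves only L = R.
  have eR : R * r = deriv f x / 2 := by
    refine (uniqueDiffWithinAt_Ioi x).eq_deriv _ (hR.comp_of_eventually_mem hr hφ ?_) (hmid _)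
    filter_upwards [hI _, self_mem_nhdsWithin] with z hz hxz
    exact hφ ▸ hf.inv_mid_strictMonoOn hy hx hz hxz
  have eL : L * l = deriv f x / 2 := by
    refine (uniqueDiffWithinAt_Iio x).eq_deriv _ (hL.comp_of_eventually_mem hl hφ ?_) (hmid _)
    filter_upwards [hI _, self_mem_nhdsWithin] with z hz hxz
    exact hφ ▸ hf.inv_mid_strictMonoOn hy hz hx hxz
  have hEq : L = R := by
    refine le_antisymm hLR ?_
    by_contra! hlt
    have : L * l < R * r := by nlinarith
    linarith
  subst hEq
  exact (hasDerivAt_of_Iio_Ioi hL hR).differentiableAt.hasDerivAt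

theorem deriv_pos (hf : IsIncreasingGenerator I f) (h : QuasiMeanConvex I f)
    {x : ℝ} (hx : x ∈ I) : 0 < deriv f x :=
  hf.deriv_pos_of_hasDerivAt h hx (hf.hasDerivAt_deriv h hx)

/-- For fixed second argument w, convexity makes f'(t)/f'(M(t, w)) nondecreasing in t. Comparing t =
x with t = y, for w = x and for w = y, gives f'(x) ≤ f'(m) ≤ f'(y) with m = M(x, y). -/
theorem deriv_monotoneOn (hf : IsIncreasingGenerator I f) (h : QuasiMeanConvex I f) :
    MonotoneOn (deriv f) I := by
  have key : ∀ y ∈ I, MonotoneOn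
      (fun x => (deriv f (Function.invFunOn f I ((f x + f y) / 2)))⁻¹ * (deriv f x / 2)) I := by
    intro y hy
    have hd : ∀ x ∈ I, HasDerivAt (fun x => Function.invFunOn f I ((f x + f y) / 2))
        ((deriv f (Function.invFunOn f I ((f x + f y) / 2)))⁻¹ * (deriv f x / 2)) x := by
      intro x hx
      have hs := hf.mid_mem_image hx hy
      have h1 := hf.inv_hasDerivAt hs (hf.hasDerivAt_deriv h (inv_mem hs))
        (hf.deriv_pos h (inv_mem hs)).ne'
      exact HasDerivAt.comp x h1 (((hf.hasDerivAt_deriv h hx).add_const (f y)).div_const 2)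
    exact ((h.convexOn_left hf.convex hy).monotoneOn_deriv
      fun x hx => (hd x hx).differentiableAt).congr fun x hx => (hd x hx).deriv
  intro x hx y hy hxy
  have hm := inv_mem (hf.mid_mem_image hx hy)
  have h1 := key x hx hx hy hxy
  have h2 := key y hy hx hy hxy
  simp only [hf.inv_mid_self hx, hf.inv_mid_self hy, add_comm (f y) (f x)] at h1 h2
  set m := Function.invFunOn f I ((f x + f y) / 2)
  have px := hf.deriv_pos h hx
  have py := hf.deriv_pos h hy
  have pm := hf.deriv_pos h hm
  field_simp at h1 h2
  linarith

theorem deriv_continuousOn (hf : IsIncreasingGenerator I f) (h : QuasiMeanConvex I f) :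
    ContinuousOn (deriv f) I :=
  continuousOn_of_monotoneOn_hasDerivAt hf.isOpen hf.ordConnected
    (fun _ hx => hf.hasDerivAt_deriv h hx) (hf.deriv_monotoneOn h)

end IsIncreasingGenerator

/-! ### First- and second-order conditions along lines -/

namespace IsIncreasingGenerator

variable {I : Set ℝ} {f f' f'' : ℝ → ℝ}

theorem quasiMean_mem (hf : IsIncreasingGenerator I f) {n : ℕ} (hn : 1 ≤ n) {a : Fin n → ℝ}
    (ha : ∀ i, a i ∈ I) : quasiMean I f a ∈ I := inv_mem (hf.mean_mem_image hn ha)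

theorem hasDerivAt_quasiMean_line (hf : IsIncreasingGenerator I f)
    (hf' : ∀ x ∈ I, HasDerivAt f (f' x) x) (hpos : ∀ x ∈ I, 0 < f' x) {n : ℕ} (hn : 1 ≤ n)
    {a b : Fin n → ℝ} {t : ℝ} (ht : ∀ i, a i + t * b i ∈ I) :
    HasDerivAt (fun t => quasiMean I f fun i => a i + t * b i)
      ((f' (quasiMean I f fun i => a i + t * b i))⁻¹ *
        ((∑ i, f' (a i + t * b i) * b i) / n)) t := by
  have hm := hf.quasiMean_mem hn ht
  have h1 := hf.inv_hasDerivAt (hf.mean_mem_image hn ht) (hf' _ hm) (hpos _ hm).ne'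
  have h2 : HasDerivAt (fun t => (∑ i, f (a i + t * b i)) / n)
      ((∑ i, f' (a i + t * b i) * b i) / n) t := by
    refine (HasDerivAt.fun_sum fun i _ => ?_).div_const _
    have h3 : HasDerivAt (fun t => a i + t * b i) (b i) t := by
      simpa using ((hasDerivAt_id t).mul_const (b i)).const_add (a i)
    exact HasDerivAt.comp t (hf' _ (ht i)) h3
  exact HasDerivAt.comp t h1 h2

theorem hasDerivAt_deriv_quasiMean_line (hf : IsIncreasingGenerator I f)
    (hf' : ∀ x ∈ I, HasDerivAt f (f' x) x) (hpos : ∀ x ∈ I, 0 < f' x)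
    (hf'' : ∀ x ∈ I, HasDerivAt f' (f'' x) x) {n : ℕ} (hn : 1 ≤ n)
    {a b : Fin n → ℝ} {t : ℝ} (ht : ∀ i, a i + t * b i ∈ I) :
    HasDerivAt (fun t => (f' (quasiMean I f fun i => a i + t * b i))⁻¹ *
        ((∑ i, f' (a i + t * b i) * b i) / n))
      ((f' (quasiMean I f fun i => a i + t * b i) ^ 2 *
          ((∑ i, f'' (a i + t * b i) * b i ^ 2) / n) -
        f'' (quasiMean I f fun i => a i + t * b i) *
          ((∑ i, f' (a i + t * b i) * b i) / n) ^ 2) /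
        f' (quasiMean I f fun i => a i + t * b i) ^ 3) t := by
  have hm := hf.quasiMean_mem hn ht
  have hp := hpos _ hm
  have h1 := (HasDerivAt.comp t (hf'' _ hm)
    (hf.hasDerivAt_quasiMean_line hf' hpos hn ht)).inv hp.ne'
  have h2 : HasDerivAt (fun t => (∑ i, f' (a i + t * b i) * b i) / n)
      ((∑ i, f'' (a i + t * b i) * b i * b i) / n) t := by
    refine (HasDerivAt.fun_sum fun i _ => ?_).div_const _
    have h3 : HasDerivAt (fun t => a i + t * b i) (b i) t := by
      simpa using ((hasDerivAt_id t).mul_const (b i)).const_add (a i)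
    exact (HasDerivAt.comp t (hf'' _ (ht i)) h3).mul_const _
  refine (h1.mul h2).congr_deriv ?_
  simp only [Pi.inv_apply, Function.comp_apply, mul_assoc, ← pow_two]
  field_simp
  ring

theorem line_convexOn (hf : IsIncreasingGenerator I f) (h : QuasiMeanConvex I f) {n : ℕ}
    (hn : 1 ≤ n) (a b : Fin n → ℝ) :
    ConvexOn ℝ {t : ℝ | ∀ i, a i + t * b i ∈ I} fun t => quasiMean I f fun i => a i + t * b i := by
  have hcomb : ∀ (p q s t : ℝ), p + q = 1 → (fun i => a i + (p • s + q • t) * b i) =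
      p • (fun i => a i + s * b i) + q • fun i => a i + t * b i := by
    intro p q s t hpq
    obtain rfl : p = 1 - q := by linarith
    ext i
    simp only [smul_eq_mul, Pi.add_apply, Pi.smul_apply]
    ring
  refine ⟨fun s hs t ht p q hp hq hpq i => ?_, fun s hs t ht p q hp hq hpq => ?_⟩
  · have h1 := hf.convex (hs i) (ht i) hp hq hpq
    have h2 := congrFun (hcomb p q s t hpq) i
    simp only [Pi.add_apply, Pi.smul_apply] at h2
    rwa [h2]
  · have := (h n hn).2 (fun i _ => hs i) (fun i _ => ht i) hp hq hpq
    simp only [hcomb p q s t hpq]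
    exact this

theorem line_mem_nhds (hf : IsIncreasingGenerator I f) {n : ℕ} {a : Fin n → ℝ}
    (ha : ∀ i, a i ∈ I) (b : Fin n → ℝ) : {t : ℝ | ∀ i, a i + t * b i ∈ I} ∈ 𝓝 (0 : ℝ) := by
  refine eventually_all.2 fun i => ?_
  have hc : ContinuousAt (fun t : ℝ => a i + t * b i) 0 := by fun_prop
  exact hc.preimage_mem_nhds (by simpa using hf.isOpen.mem_nhds (ha i))

/-- Supporting hyperplane inequality for a convex quasiarithmetic mean. -/
theorem first_order_condition (hf : IsIncreasingGenerator I f) (h : QuasiMeanConvex I f)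
    (hf' : ∀ x ∈ I, HasDerivAt f (f' x) x) (hpos : ∀ x ∈ I, 0 < f' x) {n : ℕ} (hn : 1 ≤ n)
    {a c : Fin n → ℝ} (ha : ∀ i, a i ∈ I) (hc : ∀ i, c i ∈ I) :
    (∑ i, f' (a i) * (c i - a i)) / n ≤
      f' (quasiMean I f a) * (quasiMean I f c - quasiMean I f a) := by
  have hd := hf.hasDerivAt_quasiMean_line hf' hpos hn (a := a) (b := fun i => c i - a i) (t := 0)
    (by simpa using ha)
  have := (hf.line_convexOn h hn a fun i => c i - a i).le_slope_of_hasDerivAt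
    (x := 0) (y := 1) (by simpa using ha) (by simpa using hc) one_pos hd
  simp only [slope_def_field, zero_mul, add_zero, one_mul, add_sub_cancel, sub_zero,
    div_one] at this
  rwa [inv_mul_le_iff₀ (hpos _ (hf.quasiMean_mem hn ha))] at this

/-- Nonnegativity of the Hessian of a convex quasiarithmetic mean. -/
theorem second_order_condition (hf : IsIncreasingGenerator I f) (h : QuasiMeanConvex I f)
    (hf' : ∀ x ∈ I, HasDerivAt f (f' x) x) (hpos : ∀ x ∈ I, 0 < f' x)
    (hf'' : ∀ x ∈ I, HasDerivAt f' (f'' x) x) {n : ℕ} (hn : 1 ≤ n)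
    {a : Fin n → ℝ} (ha : ∀ i, a i ∈ I) (b : Fin n → ℝ) :
    f'' (quasiMean I f a) * ((∑ i, f' (a i) * b i) / n) ^ 2 ≤
      f' (quasiMean I f a) ^ 2 * ((∑ i, f'' (a i) * b i ^ 2) / n) := by
  have h2 := hf.hasDerivAt_deriv_quasiMean_line hf' hpos hf'' hn (a := a) (b := b) (t := 0)
    (by simpa using ha)
  have := (hf.line_convexOn h hn a b).second_deriv_nonneg (hf.line_mem_nhds ha b)
    (fun t ht => hf.hasDerivAt_quasiMean_line hf' hpos hn ht) h2
  simp only [zero_mul, add_zero] at this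
  have hp := hpos _ (hf.quasiMean_mem hn ha)
  rw [le_div_iff₀ (by positivity), zero_mul] at this
  linarith

/-- The second-order condition is sufficient for convexity. -/
theorem quasiMeanConvex_of_second_order (hf : IsIncreasingGenerator I f)
    (hf' : ∀ x ∈ I, HasDerivAt f (f' x) x) (hpos : ∀ x ∈ I, 0 < f' x)
    (hf'' : ∀ x ∈ I, HasDerivAt f' (f'' x) x)
    (hsec : ∀ n : ℕ, 1 ≤ n → ∀ a : Fin n → ℝ, (∀ i, a i ∈ I) → ∀ b : Fin n → ℝ,
      f'' (quasiMean I f a) * ((∑ i, f' (a i) * b i) / n) ^ 2 ≤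
        f' (quasiMean I f a) ^ 2 * ((∑ i, f'' (a i) * b i ^ 2) / n)) :
    QuasiMeanConvex I f := by
  intro n hn
  refine ⟨convex_pi fun _ _ => hf.convex, fun a ha c hc p q hp hq hpq => ?_⟩
  have hmem : ∀ t ∈ Icc (0 : ℝ) 1, ∀ i, a i + t * (c i - a i) ∈ I := by
    intro t ht i
    have := hf.convex (ha i trivial) (hc i trivial) (sub_nonneg.2 ht.2) ht.1 (by ring)
    simp only [smul_eq_mul] at this
    convert this using 1
    ring
  have hconv : ConvexOn ℝ (Icc (0 : ℝ) 1)
      fun t => quasiMean I f fun i => a i + t * (c i - a i) := by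
    refine convexOn_of_hasDerivWithinAt2_nonneg (convex_Icc 0 1)
      (fun t ht => (hf.hasDerivAt_quasiMean_line hf' hpos hn
        (hmem t ht)).continuousAt.continuousWithinAt)
      (fun t ht => (hf.hasDerivAt_quasiMean_line hf' hpos hn
        (hmem t (interior_subset ht))).hasDerivWithinAt)
      (fun t ht => (hf.hasDerivAt_deriv_quasiMean_line hf' hpos hf'' hn
        (hmem t (interior_subset ht))).hasDerivWithinAt) fun t ht => ?_
    have hm := hmem t (interior_subset ht)
    have := hpos _ (hf.quasiMean_mem hn hm)
    exact div_nonneg (sub_nonneg.2 (hsec n hn _ hm _)) (by positivity)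
  have := hconv.2 (x := 0) (by simp) (y := 1) (by simp) hp hq hpq
  obtain rfl : p = 1 - q := by linarith
  simp only [smul_eq_mul, mul_zero, mul_one, zero_add, zero_mul, add_zero, one_mul,
    add_sub_cancel] at this
  have hpt : (fun i => a i + q * (c i - a i)) = (1 - q) • a + q • c := by
    ext i
    simp only [Pi.add_apply, Pi.smul_apply, smul_eq_mul]
    ring
  rwa [hpt] at this

end IsIncreasingGenerator

/-! ### Existence and continuity of the second derivative -/

namespace IsIncreasingGenerator

variable {I : Set ℝ} {f f' f'' : ℝ → ℝ}

theorem quasiMean_pair (x y : ℝ) :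
    quasiMean I f ![x, y] = Function.invFunOn f I ((f x + f y) / 2) := by
  simp [quasiMean]

theorem inv_continuousOn (hf : IsIncreasingGenerator I f) :
    ContinuousOn (Function.invFunOn f I) (f '' I) :=
  fun _ hs => (hf.inv_continuousAt hs).continuousWithinAt

theorem comp_inv_continuousOn (hf : IsIncreasingGenerator I f) {p : ℝ → ℝ}
    (hp : ContinuousOn p I) : ContinuousOn (fun s => p (Function.invFunOn f I s)) (f '' I) :=
  hp.comp hf.inv_continuousOn fun _ hs => inv_mem hs

/-- For each `y ∈ I`, the function `s ↦ (f⁻¹ s - y) f'(f⁻¹ s)` is convex on `f(I)`. -/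
theorem convexOn_gap_mul_deriv (hf : IsIncreasingGenerator I f) (h : QuasiMeanConvex I f)
    (hf' : ∀ x ∈ I, HasDerivAt f (f' x) x) (hpos : ∀ x ∈ I, 0 < f' x)
    (hcont : ContinuousOn f' I) {y : ℝ} (hy : y ∈ I) :
    ConvexOn ℝ (f '' I)
      fun s => (Function.invFunOn f I s - y) * f' (Function.invFunOn f I s) := by
  refine convexOn_of_midpoint_le hf.convex_image
    ((hf.inv_continuousOn.sub continuousOn_const).mul (hf.comp_inv_continuousOn hcont)) ?_
  rintro _ ⟨a, ha, rfl⟩ _ ⟨b, hb, rfl⟩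
  -- The hyperplane supporting the mean at `(a, b)` is tested at the diagonal point `(y, y)`, whose
  -- mean is `y`.
  have := hf.first_order_condition h hf' hpos (n := 2) (by norm_num) (a := ![a, b])
    (c := ![y, y]) (by simp [Fin.forall_fin_two, *]) (by simp [Fin.forall_fin_two, *])
  simp only [quasiMean_pair, hf.inv_mid_self hy, Fin.sum_univ_two, Matrix.cons_val_zero,
    Matrix.cons_val_one, Nat.cast_ofNat] at this
  simp only [hf.inv_apply ha, hf.inv_apply hb]
  linarith

/-- The generator of a convex quasiarithmetic mean, transported to its own image, has a
differentiable derivative. -/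
theorem exists_hasDerivAt_deriv_comp_inv (hf : IsIncreasingGenerator I f)
    (h : QuasiMeanConvex I f) (hf' : ∀ x ∈ I, HasDerivAt f (f' x) x)
    (hpos : ∀ x ∈ I, 0 < f' x) (hcont : ContinuousOn f' I) {s : ℝ} (hs : s ∈ f '' I) :
    ∃ d, HasDerivAt (fun s => f' (Function.invFunOn f I s)) d s := by
  set k := Function.invFunOn f I with hk
  have hx := inv_mem hs
  obtain ⟨l, r, hlr, hsub⟩ := mem_nhds_iff_exists_Ioo_subset.1 (hf.isOpen.mem_nhds hx)
  obtain ⟨p, hp1, hp2⟩ := exists_between hlr.1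
  obtain ⟨q, hq1, hq2⟩ := exists_between hlr.2
  have hp : p ∈ I := hsub ⟨hp1, hp2.trans hlr.2⟩
  have hq : q ∈ I := hsub ⟨hlr.1.trans hq1, hq2⟩
  have hpq : q - p ≠ 0 := by linarith
  have hcp := hf.convexOn_gap_mul_deriv h hf' hpos hcont hp
  have hcq := hf.convexOn_gap_mul_deriv h hf' hpos hcont hq
  have hsi : s ∈ interior (f '' I) := by rwa [hf.isOpen_image.interior_eq]
  -- A difference of two convex functions, hence one-sidedly differentiable.
  have hu : ∀ t, f' (k t) = ((k t - p) * f' (k t) - (k t - q) * f' (k t)) / (q - p) := by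
    intro t
    field_simp
    ring
  have hR : DifferentiableWithinAt ℝ (fun s => f' (k s)) (Ioi s) s := by
    have := ((hcp.differentiableWithinAt_Ioi_of_mem_interior hsi).sub
      (hcq.differentiableWithinAt_Ioi_of_mem_interior hsi)).div_const (q - p)
    exact this.congr (fun t _ => hu t) (hu s)
  have hL : DifferentiableWithinAt ℝ (fun s => f' (k s)) (Iio s) s := by
    have := ((hcp.differentiableWithinAt_Iio_of_mem_interior hsi).sub
      (hcq.differentiableWithinAt_Iio_of_mem_interior hsi)).div_const (q - p)
    exact this.congr (fun t _ => hu t) (hu s)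
  set R := derivWithin (fun s => f' (k s)) (Ioi s) s
  set L := derivWithin (fun s => f' (k s)) (Iio s) s
  have hkd : HasDerivAt k (f' (k s))⁻¹ s := hf.inv_hasDerivAt hs (hf' _ hx) (hpos _ hx).ne'
  -- The derivative of a convex function jumps upwards, and `k` is differentiable, so the jump comes
  -- from f' ∘ k alone. Taking `y` on either side of `k s` forces `R = L`.
  have key : ∀ y ∈ I, 0 ≤ (k s - y) * (R - L) := by
    intro y hy
    have hc := hf.convexOn_gap_mul_deriv h hf' hpos hcont hy
    have h1 := hc.leftDeriv_le_rightDeriv_of_mem_interior hsi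
    have h2 := ((hkd.hasDerivWithinAt (s := Iio s)).sub_const y).mul hL.hasDerivWithinAt
    have h3 := ((hkd.hasDerivWithinAt (s := Ioi s)).sub_const y).mul hR.hasDerivWithinAt
    have e2 := h2.derivWithin (uniqueDiffWithinAt_Iio s)
    have e3 := h3.derivWithin (uniqueDiffWithinAt_Ioi s)
    have h4 := e2.symm.le.trans (h1.trans e3.le)
    linarith
  have h1 := key p hp
  have h2 := key q hq
  have hLR : R = L := by
    have h3 : 0 ≤ R - L := nonneg_of_mul_nonneg_right h1 (sub_pos.2 hp2)
    have h4 : R - L ≤ 0 := by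
      by_contra! hcon
      have := mul_neg_of_neg_of_pos (sub_neg.2 hq1) hcon
      linarith
    linarith
  refine ⟨R, hasDerivAt_of_Iio_Ioi ?_ hR.hasDerivWithinAt⟩
  rw [hLR]
  exact hL.hasDerivWithinAt

/-- The generator of a convex quasiarithmetic mean is twice continuously differentiable. -/
theorem exists_continuous_second_deriv (hf : IsIncreasingGenerator I f)
    (h : QuasiMeanConvex I f) (hf' : ∀ x ∈ I, HasDerivAt f (f' x) x)
    (hpos : ∀ x ∈ I, 0 < f' x) (hcont : ContinuousOn f' I) :
    ∃ f'' : ℝ → ℝ, (∀ x ∈ I, HasDerivAt f' (f'' x) x) ∧ ContinuousOn f'' I := by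
  have hex := fun s (hs : s ∈ f '' I) =>
    hf.exists_hasDerivAt_deriv_comp_inv h hf' hpos hcont hs
  set k := Function.invFunOn f I with hk
  set v := deriv fun s => f' (k s) with hv
  have hu : ∀ s ∈ f '' I, HasDerivAt (fun s => f' (k s)) (v s) s := fun s hs => by
    obtain ⟨d, hd⟩ := hex s hs
    exact hd.differentiableAt.hasDerivAt
  have hQd : ∀ y ∈ I, ∀ s ∈ f '' I,
      HasDerivAt (fun s => (k s - y) * f' (k s)) (1 + (k s - y) * v s) s := by
    intro y hy s hs
    have hx : k s ∈ I := inv_mem hs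
    have hkd : HasDerivAt k (f' (k s))⁻¹ s := hf.inv_hasDerivAt hs (hf' _ hx) (hpos _ hx).ne'
    refine ((hkd.sub_const y).mul (hu s hs)).congr_deriv ?_
    rw [inv_mul_cancel₀ (hpos _ hx).ne']
  -- Derivatives of convex functions are monotone, hence continuous; differencing two values of `y`
  -- isolates `v`.
  have hQc : ∀ y ∈ I, ContinuousOn (fun s => 1 + (k s - y) * v s) (f '' I) := by
    intro y hy
    refine continuousOn_of_monotoneOn_hasDerivAt hf.isOpen_image hf.convex_image.ordConnected
      (hQd y hy) ?_
    exact ((hf.convexOn_gap_mul_deriv h hf' hpos hcont hy).monotoneOn_deriv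
      fun s hs => (hQd y hy s hs).differentiableAt).congr fun s hs => (hQd y hy s hs).deriv
  refine ⟨fun x => v (f x) * f' x, fun x hx => ?_, ?_⟩
  · have h1 := HasDerivAt.comp x (hu _ (mem_image_of_mem f hx)) (hf' x hx)
    refine h1.congr_of_eventuallyEq ?_
    filter_upwards [hf.isOpen.mem_nhds hx] with z hz
    simp [hk, hf.inv_apply hz]
  · refine ContinuousOn.mul ?_ hcont
    suffices hvc : ContinuousOn v (f '' I) from hvc.comp hf.continuousOn (mapsTo_image f I)
    intro s hs
    obtain ⟨l, r, hlr, hsub⟩ := mem_nhds_iff_exists_Ioo_subset.1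
      (hf.isOpen.mem_nhds (inv_mem hs))
    obtain ⟨q, hq1, hq2⟩ := exists_between hlr.2
    have hq : q ∈ I := hsub ⟨hlr.1.trans hq1, hq2⟩
    have hpq : q - k s ≠ 0 := (sub_pos.2 hq1).ne'
    have := ((hQc _ (inv_mem hs)).sub (hQc q hq)).div_const (q - k s) s hs
    refine this.congr (fun t _ => ?_) ?_ <;> simp only [← hk, Pi.sub_apply] <;> field_simp <;>
      ring

end IsIncreasingGenerator

/-! ### The Hessian condition and concavity of f'/f'' -/

namespace IsIncreasingGenerator

variable {I : Set ℝ} {f f' f'' : ℝ → ℝ}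

/-- If the second derivative vanishes somewhere, it vanishes identically. -/
theorem second_deriv_eq_zero (hf : IsIncreasingGenerator I f) (h : QuasiMeanConvex I f)
    (hf' : ∀ x ∈ I, HasDerivAt f (f' x) x) (hpos : ∀ x ∈ I, 0 < f' x)
    (hf'' : ∀ x ∈ I, HasDerivAt f' (f'' x) x) (hnonneg : ∀ x ∈ I, 0 ≤ f'' x)
    (hcont : ContinuousOn f'' I) {x₀ : ℝ} (hx₀ : x₀ ∈ I) (h0 : f'' x₀ = 0) :
    ∀ x ∈ I, f'' x = 0 := by
  have hU : IsOpen {x | x ∈ I ∧ f'' x = 0} := by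
    rw [isOpen_iff_mem_nhds]
    rintro x ⟨hx, hx0⟩
    filter_upwards [hf.eventually_exists_reflection hx, hf.isOpen.mem_nhds hx]
      with m ⟨y, hy, hyx⟩ hm
    refine ⟨hm, le_antisymm ?_ (hnonneg m hm)⟩
    -- In the direction `(1, 0)` the right side is a multiple of f''(x) = 0, so f'' vanishes at
    -- every mean m near x.
    have := hf.second_order_condition h hf' hpos hf'' (n := 2) (by norm_num) (a := ![x, y])
      (by simp [Fin.forall_fin_two, *]) ![1, 0]
    simp only [quasiMean_pair, hf.inv_mid_eq hm hyx, Fin.sum_univ_two, Matrix.cons_val_zero,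
      Matrix.cons_val_one, hx0] at this
    have hp : 0 < (f' x * 1 + f' y * 0) / (2 : ℕ) := by
      have := hpos x hx
      simpa using this
    by_contra! hcon
    have := mul_pos hcon (pow_pos hp 2)
    simp only [zero_mul, ne_eq, OfNat.ofNat_ne_zero, not_false_eq_true, zero_pow, mul_zero,
      add_zero, zero_div] at *
    linarith
  have hV : IsOpen {x | x ∈ I ∧ f'' x ≠ 0} := hcont.isOpen_inter_preimage hf.isOpen isOpen_ne
  have hsub := hf.ordConnected.isPreconnected.subset_left_of_subset_union hU hV
    (Set.disjoint_left.2 fun x hx hx' => hx'.2 hx.2)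
    (fun x hx => (em (f'' x = 0)).imp (fun e => ⟨hx, e⟩) fun e => ⟨hx, e⟩) ⟨x₀, hx₀, hx₀, h0⟩
  exact fun x hx => (hsub hx).2

/-- Convexity of the mean forces concavity of `(f'² / f'') ∘ f⁻¹`. -/
theorem convexOn_neg_sq_div_comp_inv (hf : IsIncreasingGenerator I f) (h : QuasiMeanConvex I f)
    (hf' : ∀ x ∈ I, HasDerivAt f (f' x) x) (hpos : ∀ x ∈ I, 0 < f' x)
    (hf'' : ∀ x ∈ I, HasDerivAt f' (f'' x) x) (hpos' : ∀ x ∈ I, 0 < f'' x)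
    (hcont : ContinuousOn f'' I) :
    ConvexOn ℝ (f '' I) fun s =>
      -(f' (Function.invFunOn f I s) ^ 2 / f'' (Function.invFunOn f I s)) := by
  have hcont' : ContinuousOn f' I := fun x hx => (hf'' x hx).continuousAt.continuousWithinAt
  have hP : ContinuousOn (fun x => -(f' x ^ 2 / f'' x)) I :=
    ((hcont'.pow 2).div hcont fun x hx => (hpos' x hx).ne').neg
  refine convexOn_of_midpoint_le hf.convex_image (hf.comp_inv_continuousOn hP) ?_
  rintro _ ⟨x, hx, rfl⟩ _ ⟨y, hy, rfl⟩
  -- The direction f'/f'' is the equality case of Cauchy-Schwarz: both averages become `A`, and one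
  -- factor `A` cancels.
  have := hf.second_order_condition h hf' hpos hf'' (n := 2) (by norm_num) (a := ![x, y])
    (by simp [Fin.forall_fin_two, *]) ![f' x / f'' x, f' y / f'' y]
  simp only [quasiMean_pair, Fin.sum_univ_two, Matrix.cons_val_zero, Matrix.cons_val_one,
    Nat.cast_ofNat] at this
  have hm := inv_mem (hf.mid_mem_image hx hy)
  simp only [hf.inv_apply hx, hf.inv_apply hy]
  set m := Function.invFunOn f I ((f x + f y) / 2)
  have hx1 := hpos x hx
  have hy1 := hpos y hy
  have hx2 := hpos' x hx
  have hy2 := hpos' y hy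
  have hm2 := hpos' m hm
  set A := (f' x ^ 2 / f'' x + f' y ^ 2 / f'' y) / 2 with hA
  have e1 : (f' x * (f' x / f'' x) + f' y * (f' y / f'' y)) / 2 = A := by
    rw [hA]; ring
  have e2 : (f'' x * (f' x / f'' x) ^ 2 + f'' y * (f' y / f'' y) ^ 2) / 2 = A := by
    rw [hA]; field_simp
  rw [e1, e2] at this
  have hA0 : 0 < A := by positivity
  have h3 : A ≤ f' m ^ 2 / f'' m := by
    rw [le_div_iff₀ hm2]
    nlinarith
  linarith

/-- Convexity of the mean forces concavity of `f' / f''`: its right derivative is that of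
`(f'² / f'') ∘ f⁻¹`, shifted by a constant. -/
theorem concaveOn_ratio (hf : IsIncreasingGenerator I f) (h : QuasiMeanConvex I f)
    (hf' : ∀ x ∈ I, HasDerivAt f (f' x) x) (hpos : ∀ x ∈ I, 0 < f' x)
    (hf'' : ∀ x ∈ I, HasDerivAt f' (f'' x) x) (hpos' : ∀ x ∈ I, 0 < f'' x)
    (hcont : ContinuousOn f'' I) : ConcaveOn ℝ I fun x => f' x / f'' x := by
  have hN := hf.convexOn_neg_sq_div_comp_inv h hf' hpos hf'' hpos' hcont
  set N : ℝ → ℝ := fun s =>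
    -(f' (Function.invFunOn f I s) ^ 2 / f'' (Function.invFunOn f I s)) with hNdef
  have hcont' : ContinuousOn f' I := fun x hx => (hf'' x hx).continuousAt.continuousWithinAt
  rw [← neg_convexOn_iff]
  refine convexOn_of_monotoneOn_rightDeriv
    (D := fun x => derivWithin N (Ioi (f x)) (f x) + 1) hf.convex
    (hcont'.div hcont fun x hx => (hpos' x hx).ne').neg (fun x hx => ?_) ?_
  · have hsi : f x ∈ interior (f '' I) := by
      rw [hf.isOpen_image.interior_eq]
      exact mem_image_of_mem f hx
    have hI : ∀ᶠ z in 𝓝[Ioi x] x, z ∈ I := mem_nhdsWithin_of_mem_nhds (hf.isOpen.mem_nhds hx)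
    have h1 := (hN.hasDerivWithinAt_rightDeriv_of_mem_interior hsi).comp_of_eventually_mem
      (hf' x hx).hasDerivWithinAt rfl (s := Ioi x) (by
        filter_upwards [hI, self_mem_nhdsWithin] with z hz hxz using hf.strictMonoOn hx hz hxz)
    -- Since -f'/f'' = (N ∘ f)/f', differentiating the denominator contributes -N(f(x))
    -- f''(x)/f'(x)² = 1.
    have h2 := h1.div (hf'' x hx).hasDerivWithinAt (hpos x hx).ne'
    have heq : ∀ z ∈ I, -(f' z / f'' z) = N (f z) / f' z := by
      intro z hz
      have := hpos z hz
      have := hpos' z hz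
      simp only [hNdef, hf.inv_apply hz]
      field_simp
    refine (h2.congr_of_eventuallyEq ?_ (heq x hx)).congr_deriv ?_
    · filter_upwards [hI] with z hz using heq z hz
    · have := hpos x hx
      have := hpos' x hx
      have hNx : N (f x) = -(f' x ^ 2 / f'' x) := by simp only [hNdef, hf.inv_apply hx]
      rw [hNx]
      field_simp
      ring
  · intro x hx y hy hxy
    have := hN.monotoneOn_rightDeriv (by
      rw [hf.isOpen_image.interior_eq]; exact mem_image_of_mem f hx) (by
      rw [hf.isOpen_image.interior_eq]; exact mem_image_of_mem f hy)
      (hf.strictMonoOn.monotoneOn hx hy hxy)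
    simp only at this ⊢
    linarith

/-- Concavity of `f' / f''` gives concavity of `(f'² / f'') ∘ f⁻¹`. -/
theorem convexOn_neg_sq_div_comp_inv_of_concaveOn (hf : IsIncreasingGenerator I f)
    (hf' : ∀ x ∈ I, HasDerivAt f (f' x) x) (hpos : ∀ x ∈ I, 0 < f' x)
    (hf'' : ∀ x ∈ I, HasDerivAt f' (f'' x) x) (hpos' : ∀ x ∈ I, 0 < f'' x)
    (hcont : ContinuousOn f'' I) (hg : ConcaveOn ℝ I fun x => f' x / f'' x) :
    ConvexOn ℝ (f '' I) fun s =>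
      -(f' (Function.invFunOn f I s) ^ 2 / f'' (Function.invFunOn f I s)) := by
  have hcont' : ContinuousOn f' I := fun x hx => (hf'' x hx).continuousAt.continuousWithinAt
  have hP : ContinuousOn (fun x => -(f' x ^ 2 / f'' x)) I :=
    ((hcont'.pow 2).div hcont fun x hx => (hpos' x hx).ne').neg
  have hg' := neg_convexOn_iff.2 hg
  set g : ℝ → ℝ := -fun x => f' x / f'' x with hgdef
  refine convexOn_of_monotoneOn_rightDeriv
    (D := fun s => derivWithin g (Ioi (Function.invFunOn f I s)) (Function.invFunOn f I s) - 1)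
    hf.convex_image (hf.comp_inv_continuousOn hP) (fun s hs => ?_) ?_
  · have hx := inv_mem hs
    have hxi : Function.invFunOn f I s ∈ interior I := by rwa [hf.isOpen.interior_eq]
    have hk := hf.inv_hasDerivAt hs (hf' _ hx) (hpos _ hx).ne'
    have hev : ∀ᶠ t in 𝓝[Ioi s] s, t ∈ f '' I :=
      mem_nhdsWithin_of_mem_nhds (hf.isOpen_image.mem_nhds hs)
    have h1 := ((hf'' _ hx).hasDerivWithinAt.mul
      (hg'.hasDerivWithinAt_rightDeriv_of_mem_interior hxi)).comp_of_eventually_mem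
      hk.hasDerivWithinAt rfl (s := Ioi s) (by
        filter_upwards [hev, self_mem_nhdsWithin] with t ht hst
          using hf.inv_strictMonoOn hs ht hst)
    -- The same computation backwards: in the product f' · g the derivative of f' contributes f''
    -- g/f' = -1.
    have heq : ∀ t, -(f' (Function.invFunOn f I t) ^ 2 / f'' (Function.invFunOn f I t)) =
        (f' * g) (Function.invFunOn f I t) := by
      intro t
      simp only [hgdef, Pi.mul_apply, Pi.neg_apply]
      ring
    refine (h1.congr (fun t _ => heq t) (heq s)).congr_deriv ?_
    have := hpos _ hx
    have := hpos' _ hx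
    simp only [hgdef, Pi.neg_apply]
    field_simp
    ring
  · intro s hs t ht hst
    have := hg'.monotoneOn_rightDeriv (by
      rw [hf.isOpen.interior_eq]; exact inv_mem hs) (by
      rw [hf.isOpen.interior_eq]; exact inv_mem ht)
      (hf.inv_strictMonoOn.monotoneOn hs ht hst)
    simp only at this ⊢
    linarith

/-- If `f' / f''` is positive and concave, then the mean is convex, by Jensen and
Cauchy-Schwarz. -/
theorem quasiMeanConvex_of_concaveOn_ratio (hf : IsIncreasingGenerator I f)
    (hf' : ∀ x ∈ I, HasDerivAt f (f' x) x) (hpos : ∀ x ∈ I, 0 < f' x)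
    (hf'' : ∀ x ∈ I, HasDerivAt f' (f'' x) x) (hpos' : ∀ x ∈ I, 0 < f'' x)
    (hcont : ContinuousOn f'' I) (hg : ConcaveOn ℝ I fun x => f' x / f'' x) :
    QuasiMeanConvex I f := by
  refine hf.quasiMeanConvex_of_second_order hf' hpos hf'' fun n hn a ha b => ?_
  have hn0 : (n : ℝ) ≠ 0 := by positivity
  have hn1 : (0 : ℝ) < n := by positivity
  have hN := hf.convexOn_neg_sq_div_comp_inv_of_concaveOn hf' hpos hf'' hpos' hcont hg
  have hJ := hN.map_sum_le (t := Finset.univ) (w := fun _ : Fin n => (n : ℝ)⁻¹)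
    (p := fun i => f (a i)) (fun _ _ => by positivity) (by simp [hn0])
    (fun i _ => mem_image_of_mem f (ha i))
  simp only [smul_eq_mul, hf.inv_apply (ha _), ← div_eq_inv_mul, ← Finset.sum_div,
    Finset.sum_neg_distrib] at hJ
  have hm := hf.quasiMean_mem hn ha
  change -(f' (quasiMean I f a) ^ 2 / f'' (quasiMean I f a)) ≤ _ at hJ
  have hm2 := hpos' _ hm
  rw [neg_div, neg_le_neg_iff, div_le_div_iff₀ hn1 hm2] at hJ
  -- Cauchy-Schwarz for the splitting f' b = (√f'' b)(f'/√f'').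
  have hCS : (∑ i, f' (a i) * b i) ^ 2 ≤
      (∑ i, f'' (a i) * b i ^ 2) * ∑ i, f' (a i) ^ 2 / f'' (a i) := by
    refine Finset.sum_sq_le_sum_mul_sum_of_sq_le_mul _ (fun i _ => ?_) (fun i _ => ?_)
      fun i _ => ?_
    · have := hpos' _ (ha i)
      positivity
    · have := hpos' _ (ha i)
      positivity
    · have := hpos' _ (ha i)
      exact le_of_eq (by field_simp)
  have hS : 0 ≤ ∑ i, f'' (a i) * b i ^ 2 :=
    Finset.sum_nonneg fun i _ => mul_nonneg (hpos' _ (ha i)).le (sq_nonneg _)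
  rw [div_pow, mul_div_assoc', mul_div_assoc', div_le_div_iff₀ (by positivity) hn1]
  calc _ ≤ f'' (quasiMean I f a) * ((∑ i, f'' (a i) * b i ^ 2) *
          ∑ i, f' (a i) ^ 2 / f'' (a i)) * n := by gcongr
    _ = (∑ i, f'' (a i) * b i ^ 2) * n *
          ((∑ i, f' (a i) ^ 2 / f'' (a i)) * f'' (quasiMean I f a)) := by ring
    _ ≤ (∑ i, f'' (a i) * b i ^ 2) * n * (f' (quasiMean I f a) ^ 2 * n) := by gcongr
    _ = _ := by ring

end IsIncreasingGenerator

/-! ### Change of sign and conclusion -/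

theorem invFunOn_neg_neg (I : Set ℝ) (f : ℝ → ℝ) (s : ℝ) :
    Function.invFunOn (fun x => -f x) I (-s) = Function.invFunOn f I s := by
  have hp : (fun x => x ∈ I ∧ -f x = -s) = fun x => x ∈ I ∧ f x = s := by
    simp only [neg_inj]
  classical
  -- Both inverses are chosen from the same predicate, so they also agree at the default value taken
  -- off the image.
  exact congrArg (fun p : ℝ → Prop => if h : ∃ x, p x then h.choose else
    Classical.choice (inferInstance : Nonempty ℝ)) hp

theorem quasiMean_neg (I : Set ℝ) (f : ℝ → ℝ) {n : ℕ} (a : Fin n → ℝ) :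
    quasiMean I (fun x => -f x) a = quasiMean I f a := by
  simp only [quasiMean, Finset.sum_neg_distrib, neg_div, invFunOn_neg_neg]

theorem quasiMeanConvex_neg_iff (I : Set ℝ) (f : ℝ → ℝ) :
    QuasiMeanConvex I (fun x => -f x) ↔ QuasiMeanConvex I f := by
  have : ∀ n : ℕ, (quasiMean I (fun x => -f x) : (Fin n → ℝ) → ℝ) = quasiMean I f :=
    fun n => funext fun a => quasiMean_neg I f a
  simp only [QuasiMeanConvex, this]

theorem c2Sharp_neg {I : Set ℝ} {f : ℝ → ℝ} (h : C2Sharp I f) : C2Sharp I fun x => -f x :=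
  ⟨h.1.neg, fun x hx => by simpa using h.2 x hx⟩

theorem c2Sharp_neg_iff (I : Set ℝ) (f : ℝ → ℝ) : C2Sharp I (fun x => -f x) ↔ C2Sharp I f :=
  ⟨fun h => by simpa using c2Sharp_neg h, c2Sharp_neg⟩

namespace IsIncreasingGenerator

variable {I : Set ℝ} {f : ℝ → ℝ}

theorem quasiMeanConvex_iff (hf : IsIncreasingGenerator I f) :
    QuasiMeanConvex I f ↔
      C2Sharp I f ∧
        (((∀ x ∈ I, deriv (deriv f) x ≠ 0) ∧
            (∀ x ∈ I, 0 < deriv f x / deriv (deriv f) x) ∧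
            ConcaveOn ℝ I (fun x => deriv f x / deriv (deriv f) x)) ∨
          ∀ x ∈ I, deriv (deriv f) x = 0) := by
  constructor
  · intro h
    have hf' := fun x (hx : x ∈ I) => hf.hasDerivAt_deriv h hx
    have hpos := fun x (hx : x ∈ I) => hf.deriv_pos h hx
    obtain ⟨f₂, hf₂, hc₂⟩ :=
      hf.exists_continuous_second_deriv h hf' hpos (hf.deriv_continuousOn h)
    have heq : ∀ x ∈ I, deriv (deriv f) x = f₂ x := fun x hx => (hf₂ x hx).deriv
    have hf'' : ∀ x ∈ I, HasDerivAt (deriv f) (deriv (deriv f) x) x := fun x hx =>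
      (hf₂ x hx).differentiableAt.hasDerivAt
    have hcont : ContinuousOn (deriv (deriv f)) I := hc₂.congr heq
    have hnonneg : ∀ x ∈ I, 0 ≤ deriv (deriv f) x := by
      intro x hx
      have hacc := accPt_of_mem_nhds (hf.isOpen.mem_nhds hx)
      exact (hf'' x hx).hasDerivWithinAt.nonneg_of_monotoneOn hacc (hf.deriv_monotoneOn h)
    refine ⟨⟨?_, fun x hx => (hpos x hx).ne'⟩, ?_⟩
    · rw [show (2 : WithTop ℕ∞) = 1 + 1 by norm_num, contDiffOn_succ_iff_deriv_of_isOpen hf.isOpen]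
      refine ⟨fun x hx => (hf' x hx).differentiableAt.differentiableWithinAt, by simp, ?_⟩
      rw [show (1 : WithTop ℕ∞) = 0 + 1 by norm_num, contDiffOn_succ_iff_deriv_of_isOpen hf.isOpen]
      exact ⟨fun x hx => (hf'' x hx).differentiableAt.differentiableWithinAt, by simp,
        contDiffOn_zero.2 hcont⟩
    · by_cases hz : ∃ x ∈ I, deriv (deriv f) x = 0
      · obtain ⟨x, hx, hx0⟩ := hz
        exact Or.inr (hf.second_deriv_eq_zero h hf' hpos hf'' hnonneg hcont hx hx0)
      · push Not at hz
        have hpos' : ∀ x ∈ I, 0 < deriv (deriv f) x := fun x hx =>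
          lt_of_le_of_ne (hnonneg x hx) (hz x hx).symm
        exact Or.inl ⟨hz, fun x hx => div_pos (hpos x hx) (hpos' x hx),
          hf.concaveOn_ratio h hf' hpos hf'' hpos' hcont⟩
  · rintro ⟨⟨hC2, hne⟩, hcase⟩
    have hf' : ∀ x ∈ I, HasDerivAt f (deriv f x) x := fun x hx =>
      ((hC2.differentiableOn (by norm_num) x hx).differentiableAt
        (hf.isOpen.mem_nhds hx)).hasDerivAt
    have hpos : ∀ x ∈ I, 0 < deriv f x := by
      intro x hx
      have hacc := accPt_of_mem_nhds (hf.isOpen.mem_nhds hx)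
      exact lt_of_le_of_ne ((hf' x hx).hasDerivWithinAt.nonneg_of_monotoneOn hacc
        hf.strictMonoOn.monotoneOn) (hne x hx).symm
    have hC1 : ContDiffOn ℝ 1 (deriv f) I := hC2.deriv_of_isOpen hf.isOpen (by norm_num)
    have hf'' : ∀ x ∈ I, HasDerivAt (deriv f) (deriv (deriv f) x) x := fun x hx =>
      ((hC1.differentiableOn (by norm_num) x hx).differentiableAt
        (hf.isOpen.mem_nhds hx)).hasDerivAt
    have hcont : ContinuousOn (deriv (deriv f)) I :=
      hC1.continuousOn_deriv_of_isOpen hf.isOpen (by norm_num)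
    rcases hcase with ⟨-, hratio, hconc⟩ | hzero
    · exact hf.quasiMeanConvex_of_concaveOn_ratio hf' hpos hf''
        (fun x hx => (div_pos_iff_of_pos_left (hpos x hx)).1 (hratio x hx)) hcont hconc
    · refine hf.quasiMeanConvex_of_second_order hf' hpos hf'' fun n hn a ha b => ?_
      simp [hzero _ (hf.quasiMean_mem hn ha), fun i => hzero _ (ha i)]

end IsIncreasingGenerator

theorem theorem3p1 (I : Set ℝ) (hIopen : IsOpen I) (hIint : I.OrdConnected)
    (f : ℝ → ℝ) (hcont : ContinuousOn f I)
    (hmono : StrictMonoOn f I ∨ StrictAntiOn f I) :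
    QuasiMeanConvex I f ↔
      C2Sharp I f ∧
        (((∀ x ∈ I, deriv (deriv f) x ≠ 0) ∧
            (∀ x ∈ I, 0 < deriv f x / deriv (deriv f) x) ∧
            ConcaveOn ℝ I (fun x => deriv f x / deriv (deriv f) x)) ∨
          ∀ x ∈ I, deriv (deriv f) x = 0) := by
  rcases hmono with hmono | hanti
  · exact IsIncreasingGenerator.quasiMeanConvex_iff ⟨hIopen, hIint, hcont, hmono⟩
  · have := IsIncreasingGenerator.quasiMeanConvex_iff (f := fun x => -f x)
      ⟨hIopen, hIint, hcont.neg, hanti.neg⟩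
    have hd : (deriv fun x => -f x) = fun x => -deriv f x := funext fun x => deriv.fun_neg
    have hdd : deriv (fun x => -deriv f x) = fun x => -deriv (deriv f) x :=
      funext fun x => deriv.fun_neg
    simpa only [quasiMeanConvex_neg_iff, c2Sharp_neg_iff, hd, hdd, neg_div_neg_eq, neg_eq_zero,
      ne_eq] using this
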